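/- Proposition. Let $m\ge 1$, and let $H=\{z\in\mathbb{C}^3 : z_1^2+z_2^2=z_3^{m+1}+\tfrac12\}$, equipped with the restriction $\omega$ of the standard symplectic form of $\mathbb{C}^3$; this is a smooth symplectic manifold of real dimension four. An $(A_k)$-configuration in a symplectic four-manifold consists of $k$ embedded Lagrangian two-spheres $L_1,\dots,L_k$, any two of which intersect transversely, with $|L_i\cap L_j|=1$ if $|i-j|=1$ and $L_i\cap L_j=\emptyset$ if $|i-j|\ge 2$. (1) $(H,\omega)$ contains an $(A_m)$-configuration of Lagrangian two-spheres. More precisely, let $S^2\subset\mathbb{R}^3$ be the unit sphere, let $\pi:H\to\mathbb{C}^2$ be the branched covering $\pi(z)=(z_1,z_2)$, let $\sigma(z_1,z_2,z_3)=(z_1,z_2,e^{2\pi i/(m+1)}z_3)$, and let $$f:S^2\to\mathbb{C}^2,\qquad f(t_1,t_2,t_3)=(t_2(1+it_1),\,t_3(1+it_1)),$$ be the figure-eight map, which is a Lagrangian immersion for the standard symplectic form on $\mathbb{C}^2$. Then there is a lift $\tilde f:S^2\to H$, $\pi\circ\tilde f=f$, such that the images of the maps $\tilde f,\ \sigma\circ\tilde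 f,\ \dots,\ \sigma^{m-1}\circ\tilde f$, which are smooth embeddings, form an $(A_m)$-configuration of Lagrangian two-spheres in $(H,\omega)$. (2) If $m\ge 3$, then there is an $R_0$ such that for every $R\ge R_0$ the bounded domain $M=\{z\in H : |z|<R\}$ has the following properties: it is the interior of a compact symplectic manifold with contact type boundary (namely of its closure in $H$, which is a compact domain with smooth boundary, such that near the boundary $\omega$ has a primitive whose Liouville vector field points outward along the boundary); it contains an $(A_3)$-configuration of Lagrangian two-spheres; and both $[\omega]\in H^2(M;\mathbb{R})$ and $c_1(M,\omega)\in H^2(M;\mathbb{Z})$ vanish. -/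

import Mathlib

open scoped Manifold ContDiff
open Module

noncomputable section

/-- The unit two-sphere in `ℝ³`, with Mathlib's smooth structure. -/
abbrev S2 : Type := Metric.sphere (0 : EuclideanSpace ℝ (Fin 3)) 1

instance finrankEuclideanThree : Fact (finrank ℝ (EuclideanSpace ℝ (Fin 3)) = 2 + 1) :=
  ⟨by simp⟩

/-- `ℂⁿ` with its Euclidean norm. -/
abbrev Cn (n : ℕ) : Type := EuclideanSpace ℂ (Fin n)

/-- The standard symplectic form `∑ dxⱼ ∧ dyⱼ` on `ℂⁿ`. -/
def stdForm {n : ℕ} (u v : Cn n) : ℝ :=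
  ∑ j, ((u j).re * (v j).im - (u j).im * (v j).re)

/-- The polynomial `z₁² + z₂² - z₃^(m+1) - 1/2`. -/
def hyperPoly (m : ℕ) (z : Cn 3) : ℂ :=
  z 0 ^ 2 + z 1 ^ 2 - z 2 ^ (m + 1) - 1 / 2

/-- The affine hypersurface `H`: `z₁² + z₂² = z₃^(m+1) + 1/2`. -/
def hypersurface (m : ℕ) : Set (Cn 3) :=
  {z | z 0 ^ 2 + z 1 ^ 2 = z 2 ^ (m + 1) + 1 / 2}

/-- The tangent space of `H` at `z`, the kernel of the differential of its defining polynomial.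
It is a complex subspace of `ℂ³`. -/
def hyperTangent (m : ℕ) (z : Cn 3) : Submodule ℂ (Cn 3) :=
  LinearMap.ker (fderiv ℂ (hyperPoly m) z : Cn 3 →ₗ[ℂ] ℂ)

/-- `(H, ω)` is a smooth symplectic manifold of real dimension four: the defining polynomial is
regular along `H`, the tangent spaces have real dimension four, and the standard form (which is
closed, having constant coefficients) is nondegenerate on them. -/
structure IsSymplecticHypersurface (m : ℕ) : Prop where
  regular : ∀ z ∈ hypersurface m, fderiv ℂ (hyperPoly m) z ≠ 0
  dimension : ∀ z ∈ hypersurface m, finrank ℝ (hyperTangent m z) = 4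
  nondegenerate : ∀ z ∈ hypersurface m, ∀ u ∈ hyperTangent m z,
    (∀ v ∈ hyperTangent m z, stdForm u v = 0) → u = 0

/-- A smooth immersion of the two-sphere in `ℂⁿ` along which the standard form vanishes.
An immersion of this kind whose image lies in a four-dimensional symplectic submanifold
is a Lagrangian immersion into that submanifold. -/
structure IsIsotropicImmersion {n : ℕ} (f : S2 → Cn n) : Prop where
  smooth : ContMDiff (𝓡 2) 𝓘(ℝ, Cn n) ∞ f
  immersion : ∀ t : S2, Function.Injective (mfderiv (𝓡 2) 𝓘(ℝ, Cn n) f t)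
  isotropic : ∀ (t : S2) (u v : TangentSpace (𝓡 2) t),
    stdForm (n := n) (mfderiv (𝓡 2) 𝓘(ℝ, Cn n) f t u) (mfderiv (𝓡 2) 𝓘(ℝ, Cn n) f t v) = 0

/-- `f` is an embedding of the two-sphere onto a Lagrangian submanifold of `M`, where `M` is an
open subset of `H`. -/
structure IsLagrangianSphere (M : Set (Cn 3)) (f : S2 → Cn 3) : Prop
    extends IsIsotropicImmersion f where
  injective : Function.Injective f
  mem : ∀ t, f t ∈ M

/-- The tangent space to an immersed sphere in `ℂ³`, at the parameter `t`. -/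
def sphereTangent (f : S2 → Cn 3) (t : S2) : Submodule ℝ (Cn 3) :=
  LinearMap.range (mfderiv (𝓡 2) 𝓘(ℝ, Cn 3) f t).toLinearMap

/-- The spheres `L₀ = range (f 0), …, L_{k-1} = range (f (k-1))` are an `(A_k)`-configuration of
Lagrangian two-spheres in `M`, where `M` is an open subset of `H`. -/
structure IsAConfiguration (m : ℕ) (M : Set (Cn 3)) {k : ℕ} (f : Fin k → S2 → Cn 3) : Prop where
  lagrangian : ∀ i, IsLagrangianSphere M (f i)
  transverse : ∀ i j, i ≠ j → ∀ s t : S2, f i s = f j t →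
    sphereTangent (f i) s ⊔ sphereTangent (f j) t = (hyperTangent m (f i s)).restrictScalars ℝ
  adjacent : ∀ i j : Fin k, ((i : ℕ) + 1 = j ∨ (j : ℕ) + 1 = i) →
    (Set.range (f i) ∩ Set.range (f j)).ncard = 1
  distant : ∀ i j : Fin k, ((i : ℕ) + 2 ≤ j ∨ (j : ℕ) + 2 ≤ i) →
    Set.range (f i) ∩ Set.range (f j) = ∅

/-- The figure-eight map `(t₁, t₂, t₃) ↦ (t₂ (1 + i t₁), t₃ (1 + i t₁))`. -/
def figureEight (t : S2) : Cn 2 :=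
  !₂[((t : EuclideanSpace ℝ (Fin 3)) 1 : ℂ) *
        (1 + Complex.I * ((t : EuclideanSpace ℝ (Fin 3)) 0 : ℂ)),
     ((t : EuclideanSpace ℝ (Fin 3)) 2 : ℂ) *
        (1 + Complex.I * ((t : EuclideanSpace ℝ (Fin 3)) 0 : ℂ))]

/-- The projection `(z₁, z₂, z₃) ↦ (z₁, z₂)`; on `H` it is the branched covering. -/
def branchedCover (z : Cn 3) : Cn 2 := !₂[z 0, z 1]

/-- The generator `(z₁, z₂, z₃) ↦ (z₁, z₂, e^{2πi/(m+1)} z₃)` of the covering group. -/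
def deckMap (m : ℕ) (z : Cn 3) : Cn 3 :=
  !₂[z 0, z 1, Complex.exp (2 * Real.pi * Complex.I / (m + 1)) * z 2]

/-- The bounded domain `{z ∈ H : |z| < R}`. -/
def boundedDomain (m : ℕ) (R : ℝ) : Set (Cn 3) :=
  {z | ‖z‖ < R ∧ z ∈ hypersurface m}

/-- The smooth one-form `α`, defined near the part `A` of `H`, is a primitive of `ω` along `A`:
`dα = ω` on all pairs of vectors tangent to `H`. -/
def IsPrimitiveOn (m : ℕ) (A : Set (Cn 3)) (α : Cn 3 → Cn 3 [⋀^Fin 1]→L[ℝ] ℝ) : Prop :=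
  ∀ z ∈ A, ∀ u ∈ hyperTangent m z, ∀ v ∈ hyperTangent m z,
    extDeriv α z ![u, v] = stdForm u v

/-- The class of `ω` in the second de Rham cohomology of `M` (an open subset of `H`) is zero.
One-forms on `M` are written as restrictions of smooth one-forms on an open subset of `ℂ³`. -/
def SymplecticClassVanishes (m : ℕ) (M : Set (Cn 3)) : Prop :=
  ∃ (U : Set (Cn 3)) (α : Cn 3 → Cn 3 [⋀^Fin 1]→L[ℝ] ℝ),
    IsOpen U ∧ M ⊆ U ∧ ContDiffOn ℝ ∞ α U ∧ IsPrimitiveOn m M α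

/-- `M` is the interior of a compact domain with smooth boundary in `H` (the closure of `M`), and
the boundary is of contact type: `ω` has a primitive `α` on a neighbourhood of the boundary in
the domain, such that the Liouville vector field `X`, given by `ω (X, ·) = α`, points outward
along the boundary. Here `ρ` is a boundary defining function. -/
def IsInteriorOfContactTypeDomain (m : ℕ) (M : Set (Cn 3)) : Prop :=
  IsCompact (closure M) ∧
  ∃ ρ : Cn 3 → ℝ, ContDiff ℝ ∞ ρ ∧
    M = {z | z ∈ hypersurface m ∧ ρ z < 0} ∧
    closure M = {z | z ∈ hypersurface m ∧ ρ z ≤ 0} ∧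
    (∀ z ∈ hypersurface m, ρ z = 0 → ∃ v ∈ hyperTangent m z, fderiv ℝ ρ z v ≠ 0) ∧
    ∃ (U : Set (Cn 3)) (α : Cn 3 → Cn 3 [⋀^Fin 1]→L[ℝ] ℝ),
      IsOpen U ∧ {z | z ∈ hypersurface m ∧ ρ z = 0} ⊆ U ∧ ContDiffOn ℝ ∞ α U ∧
      IsPrimitiveOn m (U ∩ closure M) α ∧
      ∀ z ∈ hypersurface m, ρ z = 0 →
        ∃ X ∈ hyperTangent m z,
          (∀ v ∈ hyperTangent m z, stdForm X v = α z ![v]) ∧ 0 < fderiv ℝ ρ z X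

/-- Multiplication by `i` on `ℂⁿ`, hence on the complex subspaces `hyperTangent m z`, is a complex
structure compatible with the standard form: it preserves the form ... -/
theorem stdForm_I_smul {n : ℕ} (u v : Cn n) :
    stdForm (Complex.I • u) (Complex.I • v) = stdForm u v := by
  unfold stdForm
  refine Finset.sum_congr rfl fun j _ => ?_
  simp
  ring

/-- ... and tames it. -/
theorem stdForm_I_smul_pos {n : ℕ} (v : Cn n) (hv : v ≠ 0) :
    0 < stdForm v (Complex.I • v) := by
  have h : stdForm v (Complex.I • v) = ‖v‖ ^ 2 := by
    rw [EuclideanSpace.norm_sq_eq]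
    unfold stdForm
    refine Finset.sum_congr rfl fun j _ => ?_
    rw [Complex.sq_norm, Complex.normSq_apply]
    simp
  rw [h]
  have := norm_pos_iff.mpr hv
  positivity

/-- The first Chern class of `(M, ω)`, for `M` an open subset of `H`, vanishes in `H²(M; ℤ)`.
It is the first Chern class of `TM` with the compatible complex structure `i`, as a Čech class:
take local complex frames `e i` of `TM` over an open cover `U i`, with transition matrices `g i j`,
and choose logarithms `f i j` of their determinants, `det (g i j) = exp (2πi f i j)`. Then
the integers `f i j + f j k - f i k` are a Čech two-cocycle which represents the class up to sign.
It vanishes if, for a sufficiently fine cover, this cocycle is the coboundary of a one-cochain `n`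
of locally constant integer-valued functions. -/
def FirstChernClassVanishes (m : ℕ) (M : Set (Cn 3)) : Prop :=
  ∃ (ι : Type) (U : ι → Set (Cn 3)) (e : ι → Fin 2 → Cn 3 → Cn 3)
    (g : ι → ι → Cn 3 → Matrix (Fin 2) (Fin 2) ℂ) (f : ι → ι → Cn 3 → ℂ)
    (n : ι → ι → Cn 3 → ℤ),
    (∀ i, IsOpen (U i)) ∧ (M ⊆ ⋃ i, U i) ∧
    (∀ i a, ContinuousOn (e i a) (U i ∩ M)) ∧
    (∀ i, ∀ z ∈ U i ∩ M,
      (∀ a, e i a z ∈ hyperTangent m z) ∧ LinearIndependent ℂ (fun a => e i a z)) ∧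
    (∀ i j, ∀ z ∈ U i ∩ U j ∩ M, ∀ b, e j b z = ∑ a, g i j z a b • e i a z) ∧
    (∀ i j, ContinuousOn (f i j) (U i ∩ U j ∩ M)) ∧
    (∀ i j, ∀ z ∈ U i ∩ U j ∩ M,
      (g i j z).det = Complex.exp (2 * Real.pi * Complex.I * f i j z)) ∧
    (∀ i j, ContinuousOn (n i j) (U i ∩ U j ∩ M)) ∧
    (∀ i j k, ∀ z ∈ U i ∩ U j ∩ U k ∩ M,
      f i j z + f j k z - f i k z = (n i j z + n j k z - n i k z : ℤ))

/-- `(M, ω)`, for `M` an open subset of `H`, is the interior of a compact symplectic manifold with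
contact type boundary, contains an `(A₃)`-configuration of Lagrangian two-spheres, and has
`[ω] = 0` and `c₁(M, ω) = 0`. -/
structure SatisfiesKnottingHypotheses (m : ℕ) (M : Set (Cn 3)) : Prop where
  contactType : IsInteriorOfContactTypeDomain m M
  configuration : ∃ f : Fin 3 → S2 → Cn 3, IsAConfiguration m M f
  symplecticClass : SymplecticClassVanishes m M
  chernClass : FirstChernClassVanishes m M

end

/-! On the sphere, `f₁² + f₂² = (1 - t₁²)(1 + i t₁)²`, so a lift of `f` to `H` needs only a third
coordinate `h(t₁)` with `h^(m+1) = γ`, where `γ(s) = (1 - s²)(1 + i s)² - 1/2`. This `γ` never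
vanishes, so it has a smooth logarithm `L` (`exists_contDiff_log`), and `h = exp(L/(m+1))`. On `[-1,
1]` it is a loop winding once around `0` (`log_figureEightLoop_sub`), hence `h(1) = ζ h(-1)` with
`ζ` the generating root of unity. The map `f` identifies only the two poles, and the lift separates
them by exactly one step of `σ`. Thus each translate is embedded, and two translates meet precisely
when their exponents differ by one, at one point (`figureEightGraph_eq_cases`). The tangent planes
there are `(1 ± i)ℝ²`, which span the tangent space of `H`. The lift stays isotropic because its
third coordinate depends on one real variable only.

For the bounded domain, `ω` is exact already on `ℂ³`. The standard primitive restricts to `H` with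
Liouville field half the tangential part of the radial field, which points outward wherever it is
nonzero; it can vanish only where `|z|² < 4` (`norm_sq_lt_of_mem_orthogonal_hyperTangent`). Finally
`c₁` vanishes because frames whose cross product is the gradient of the polynomial differ by
matrices of determinant one (`hyperFrame_cross`). -/

/-! ### Smoothness and nondegeneracy of `H` -/

/-- The gradient of the defining polynomial of the hypersurface. -/
noncomputable def hyperGrad (m : ℕ) (z : Cn 3) : Fin 3 → ℂ :=
  ![2 * z 0, 2 * z 1, -((m + 1) * z 2 ^ m)]

theorem hasStrictFDerivAt_hyperPoly (m : ℕ) (z : Cn 3) :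
    HasStrictFDerivAt (hyperPoly m) (∑ j, hyperGrad m z j • EuclideanSpace.proj (𝕜 := ℂ) j) z := by
  have h (j : Fin 3) : HasStrictFDerivAt (fun w : Cn 3 => w j)
      (EuclideanSpace.proj (𝕜 := ℂ) j) z :=
    (EuclideanSpace.proj (𝕜 := ℂ) j : Cn 3 →L[ℂ] ℂ).hasStrictFDerivAt
  refine (((((h 0).pow 2).add ((h 1).pow 2)).sub ((h 2).pow (m + 1))).sub_const (1 / 2)).congr_fderiv ?_
  ext v
  simp [Fin.sum_univ_three, hyperGrad]
  ring

theorem fderiv_hyperPoly_apply (m : ℕ) (z v : Cn 3) :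
    fderiv ℂ (hyperPoly m) z v = ∑ j, hyperGrad m z j * v j := by
  rw [(hasStrictFDerivAt_hyperPoly m z).hasFDerivAt.fderiv]
  simp

theorem mem_hyperTangent_iff {m : ℕ} {z v : Cn 3} :
    v ∈ hyperTangent m z ↔ ∑ j, hyperGrad m z j * v j = 0 := by
  rw [← fderiv_hyperPoly_apply]
  exact LinearMap.mem_ker

theorem hyperPoly_eq_zero_iff {m : ℕ} {z : Cn 3} : hyperPoly m z = 0 ↔ z ∈ hypersurface m := by
  simp only [hyperPoly, hypersurface, Set.mem_ofPred_eq]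
  constructor <;> intro h <;> linear_combination h

/-- A critical point has `z₁ = z₂ = 0` and `z₃^(m+1) = 0`, and the constant `1/2` keeps such points
off `H`. -/
theorem exists_hyperGrad_ne_zero {m : ℕ} {z : Cn 3} (hz : z ∈ hypersurface m) :
    ∃ j, hyperGrad m z j ≠ 0 := by
  by_contra! h
  have h0 : z 0 = 0 := by simpa [hyperGrad] using h 0
  have h1 : z 1 = 0 := by simpa [hyperGrad] using h 1
  have h2 : z 2 ^ m = 0 := by
    have := h 2
    have hm : (m : ℂ) + 1 ≠ 0 := by exact_mod_cast m.succ_ne_zero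
    simpa only [hyperGrad, Matrix.cons_val, neg_eq_zero, mul_eq_zero, hm, false_or] using this
  have : z 0 ^ 2 + z 1 ^ 2 = z 2 ^ (m + 1) + 1 / 2 := hz
  rw [h0, h1, pow_succ (z 2), h2] at this
  norm_num at this

theorem fderiv_hyperPoly_ne_zero {m : ℕ} {z : Cn 3} (hz : z ∈ hypersurface m) :
    fderiv ℂ (hyperPoly m) z ≠ 0 := by
  obtain ⟨j, hj⟩ := exists_hyperGrad_ne_zero hz
  intro h
  apply hj
  have := fderiv_hyperPoly_apply m z (EuclideanSpace.single j 1)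
  rw [h] at this
  simpa [PiLp.single_apply] using this.symm

theorem isSymplecticHypersurface (m : ℕ) : IsSymplecticHypersurface m where
  regular _ hz := fderiv_hyperPoly_ne_zero hz
  dimension z hz := by
    have h : (fderiv ℂ (hyperPoly m) z : Cn 3 →ₗ[ℂ] ℂ) ≠ 0 := fun h =>
      fderiv_hyperPoly_ne_zero hz (ContinuousLinearMap.coe_injective h)
    have := Module.Dual.finrank_ker_add_one_of_ne_zero h
    rw [finrank_euclideanSpace_fin] at this
    rw [finrank_real_of_complex, hyperTangent]
    exact congrArg (2 * ·) (Nat.succ_injective this)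
  nondegenerate z _ u hu h := by
    by_contra h0
    -- The tangent space is complex, so `i u` is an admissible test vector.
    exact (stdForm_I_smul_pos u h0).ne' (h _ (Submodule.smul_mem _ _ hu))

theorem isClosed_hypersurface (m : ℕ) : IsClosed (hypersurface m) := by
  apply isClosed_eq <;> fun_prop

/-! ### The standard primitive -/

theorem stdForm_eq_im_inner {n : ℕ} (u v : Cn n) : stdForm u v = (inner ℂ u v).im := by
  simp only [stdForm, PiLp.inner_apply, Complex.im_sum]
  refine Finset.sum_congr rfl fun j _ => ?_
  simp
  ring

/-- The standard primitive `½ ∑ (xⱼ dyⱼ - yⱼ dxⱼ)` of the standard form. -/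
noncomputable def stdPrimitive (n : ℕ) : Cn n →L[ℝ] Cn n [⋀^Fin 1]→L[ℝ] ℝ :=
  LinearMap.toContinuousLinearMap
    { toFun := fun z => ContinuousAlternatingMap.ofSubsingleton ℝ (Cn n) ℝ (0 : Fin 1)
        ((1 / 2 : ℝ) • Complex.imCLM ∘L (innerSL ℂ z).restrictScalars ℝ)
      map_add' := fun z w => by ext v; simp
      map_smul' := fun c z => by
        ext v
        simp [inner_smul_left_eq_smul]
        ring }

theorem stdPrimitive_apply {n : ℕ} (z v : Cn n) :
    stdPrimitive n z ![v] = stdForm z v / 2 := by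
  simp [stdPrimitive, stdForm_eq_im_inner]
  ring

theorem stdForm_antisymm {n : ℕ} (u v : Cn n) : stdForm u v = -stdForm v u := by
  simp only [stdForm, ← Finset.sum_neg_distrib]
  exact Finset.sum_congr rfl fun j _ => by ring

/-- The primitive is linear in the base point, hence its own derivative; the two terms of the
exterior derivative are `ω(u, v)/2` and `-ω(v, u)/2`. -/
theorem extDeriv_stdPrimitive {n : ℕ} (z u v : Cn n) :
    extDeriv (stdPrimitive n) z ![u, v] = stdForm u v := by
  rw [extDeriv, ContinuousLinearMap.fderiv, ContinuousAlternatingMap.alternatizeUncurryFin_apply,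
    Fin.sum_univ_two]
  have h0 : (0 : Fin 2).removeNth ![u, v] = ![v] := by ext i; fin_cases i; rfl
  have h1 : (1 : Fin 2).removeNth ![u, v] = ![u] := by ext i; fin_cases i; rfl
  rw [h0, h1]
  simp only [Matrix.cons_val, stdPrimitive_apply]
  rw [stdForm_antisymm v u]
  simp
  ring

theorem isPrimitiveOn_stdPrimitive (m : ℕ) (A : Set (Cn 3)) : IsPrimitiveOn m A (stdPrimitive 3) :=
  fun z _ u _ v _ => extDeriv_stdPrimitive z u v

theorem symplecticClassVanishes (m : ℕ) (M : Set (Cn 3)) : SymplecticClassVanishes m M :=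
  ⟨Set.univ, stdPrimitive 3, isOpen_univ, Set.subset_univ _, (stdPrimitive 3).contDiff.contDiffOn,
    isPrimitiveOn_stdPrimitive m M⟩

/-! ### Vanishing of the first Chern class -/

/-- A frame `(u, v)` of the tangent spaces of `H`, where the `i`-th partial derivative of the
defining polynomial is nonzero, whose cross product is the gradient of the polynomial. -/
noncomputable def hyperFrame (m : ℕ) (i : Fin 3) (a : Fin 2) (z : Cn 3) : Cn 3 :=
  let d := hyperGrad m z
  ![WithLp.toLp 2 (fun j => if j = i then -d (i + 1) else if j = i + 1 then d i else 0),
    WithLp.toLp 2 (fun j => if j = i then -d (i + 2) / d i else if j = i + 2 then 1 else 0)] a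

theorem hyperFrame_mem {m : ℕ} {i : Fin 3} {z : Cn 3} (hi : hyperGrad m z i ≠ 0) (a : Fin 2) :
    hyperFrame m i a z ∈ hyperTangent m z := by
  rw [mem_hyperTangent_iff, Fin.sum_univ_three]
  fin_cases i <;> fin_cases a <;> simp [hyperFrame] at hi ⊢ <;> field_simp <;> ring

/-- This normalisation does not depend on the chart `j`, which forces the transition determinants to
be one. -/
theorem hyperFrame_cross {m : ℕ} {j : Fin 3} {z : Cn 3} (hj : hyperGrad m z j ≠ 0) (i : Fin 3) :
    hyperFrame m j 0 z (i + 1) * hyperFrame m j 1 z (i + 2) -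
      hyperFrame m j 0 z (i + 2) * hyperFrame m j 1 z (i + 1) = hyperGrad m z i := by
  fin_cases i <;> fin_cases j <;> simp [hyperFrame] at hj ⊢ <;> field_simp

theorem eq_sum_hyperFrame {m : ℕ} {i : Fin 3} {z w : Cn 3} (hi : hyperGrad m z i ≠ 0)
    (hw : w ∈ hyperTangent m z) :
    w = (w (i + 1) / hyperGrad m z i) • hyperFrame m i 0 z + w (i + 2) • hyperFrame m i 1 z := by
  rw [mem_hyperTangent_iff, Fin.sum_univ_three] at hw
  ext k
  fin_cases i <;> fin_cases k <;> simp [hyperFrame] at hi ⊢ <;> field_simp <;>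
    linear_combination hw

theorem linearIndependent_hyperFrame {m : ℕ} {i : Fin 3} {z : Cn 3} (hi : hyperGrad m z i ≠ 0) :
    LinearIndependent ℂ fun a => hyperFrame m i a z := by
  rw [Fintype.linearIndependent_iff]
  intro g hg
  rw [Fin.sum_univ_two] at hg
  have h1 := congrArg (fun w : Cn 3 => w (i + 1)) hg
  have h2 := congrArg (fun w : Cn 3 => w (i + 2)) hg
  fin_cases i <;> simp [hyperFrame] at hi h1 h2 <;> simp_all [Fin.forall_fin_two]

theorem continuous_hyperGrad (m : ℕ) (i : Fin 3) : Continuous fun z => hyperGrad m z i := by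
  fin_cases i <;> simp [hyperGrad] <;> fun_prop

theorem firstChernClassVanishes {m : ℕ} {M : Set (Cn 3)} (hM : M ⊆ hypersurface m) :
    FirstChernClassVanishes m M := by
  refine ⟨Fin 3, fun i => {z | hyperGrad m z i ≠ 0}, hyperFrame m,
    fun i j z => !![hyperFrame m j 0 z (i + 1) / hyperGrad m z i,
      hyperFrame m j 1 z (i + 1) / hyperGrad m z i;
      hyperFrame m j 0 z (i + 2), hyperFrame m j 1 z (i + 2)],
    -- All transition determinants are one, so zero logarithms and the zero cochain suffice.
    0, 0, ?_, ?_, ?_, ?_, ?_, ?_, ?_, ?_, ?_⟩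
  · exact fun i => isOpen_ne_fun (continuous_hyperGrad m i) continuous_const
  · intro z hz
    simpa using exists_hyperGrad_ne_zero (hM hz)
  · intro i a
    have h (k : Fin 3) := (continuous_hyperGrad m k).continuousOn
      (s := {z | hyperGrad m z i ≠ 0} ∩ M)
    refine (PiLp.continuous_toLp 2 _).comp_continuousOn (continuousOn_pi.2 fun j => ?_)
    revert a
    rw [Fin.forall_fin_two]
    constructor
    · change ContinuousOn (fun z => if j = i then -hyperGrad m z (i + 1) else
        if j = i + 1 then hyperGrad m z i else 0) _
      split_ifs
      exacts [(h _).neg, h _, continuousOn_const]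
    · change ContinuousOn (fun z => if j = i then -hyperGrad m z (i + 2) / hyperGrad m z i else
        if j = i + 2 then 1 else 0) _
      split_ifs
      exacts [(h _).neg.div (h _) fun z hz => hz.1, continuousOn_const, continuousOn_const]
  · exact fun i z hz => ⟨hyperFrame_mem hz.1, linearIndependent_hyperFrame hz.1⟩
  · rintro i j z ⟨⟨hi, hj⟩, -⟩ b
    rw [Fin.sum_univ_two]
    conv_lhs => rw [eq_sum_hyperFrame hi (hyperFrame_mem hj b)]
    fin_cases b <;> simp
  · exact fun i j => continuousOn_const
  · rintro i j z ⟨⟨hi, hj⟩, -⟩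
    have hi : hyperGrad m z i ≠ 0 := hi
    have := hyperFrame_cross hj i
    simp only [Matrix.det_fin_two_of, Pi.zero_apply, mul_zero, Complex.exp_zero]
    field_simp
    linear_combination this
  · exact fun i j => continuousOn_const
  · simp

/-! ### Contact type boundary -/

/-- Orthogonality makes `z` parallel to the conjugate gradient. This bounds `|z₃|` by `1`, and the
equation of `H` then gives `|z₁|² + |z₂|² ≤ 3/2`. -/
theorem norm_sq_lt_of_mem_orthogonal_hyperTangent {m : ℕ} (hm : 2 ≤ m) {z : Cn 3}
    (hz : z ∈ hypersurface m) (h : z ∈ (hyperTangent m z)ᗮ) : ‖z‖ ^ 2 < 4 := by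
  have hT (v : Cn 3) (hv : v ∈ hyperTangent m z) : inner ℂ v z = 0 :=
    (Submodule.mem_orthogonal _ _).1 h v hv
  have h01 := hT !₂[-z 1, z 0, 0] (by
    rw [mem_hyperTangent_iff]; simp [Fin.sum_univ_three, hyperGrad]; ring)
  have h02 := hT !₂[(m + 1) * z 2 ^ m, 0, 2 * z 0] (by
    rw [mem_hyperTangent_iff]; simp [Fin.sum_univ_three, hyperGrad]; ring)
  have h12 := hT !₂[0, (m + 1) * z 2 ^ m, 2 * z 1] (by
    rw [mem_hyperTangent_iff]; simp [Fin.sum_univ_three, hyperGrad]; ring)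
  simp only [PiLp.inner_apply, Fin.sum_univ_three, RCLike.inner_apply, Matrix.cons_val,
    map_zero, mul_zero, add_zero, zero_add, map_neg, mul_neg] at h01 h02 h12
  have hH : z 0 ^ 2 + z 1 ^ 2 = z 2 ^ (m + 1) + 1 / 2 := hz
  have hz2 : ‖z 2‖ ≤ 1 := by
    -- Taking norms gives `(m+1)|z₃|^m = 2|z₃|`, impossible for `|z₃| > 1` once `m + 1 > 2`.
    have key (x : ℂ) (hx : x ≠ 0)
        (hx2 : x * (starRingEnd ℂ) ((m + 1) * z 2 ^ m) + z 2 * (starRingEnd ℂ) (2 * x) = 0) :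
        ‖z 2‖ ≤ 1 := by
      by_contra! h1
      have e : ‖x * (starRingEnd ℂ) ((m + 1) * z 2 ^ m)‖ = ‖z 2 * (starRingEnd ℂ) (2 * x)‖ := by
        rw [eq_neg_of_add_eq_zero_left hx2, norm_neg]
      have hm1 : ‖(m : ℂ) + 1‖ = m + 1 := by
        rw [← Nat.cast_succ, Complex.norm_natCast]
        simp
      simp only [norm_mul, RCLike.norm_conj, norm_pow, hm1, Complex.norm_ofNat] at e
      have hx' : 0 < ‖x‖ := norm_pos_iff.2 hx
      have e' : (m + 1) * ‖z 2‖ ^ m = 2 * ‖z 2‖ :=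
        mul_left_cancel₀ hx'.ne' (by linear_combination e)
      have : ‖z 2‖ ^ 1 ≤ ‖z 2‖ ^ m := pow_le_pow_right₀ h1.le (by lia)
      have hm' : (2 : ℝ) ≤ m := by exact_mod_cast hm
      nlinarith
    by_cases h0 : z 0 = 0
    · by_cases h1 : z 1 = 0
      · by_contra! h2
        have e : z 2 ^ (m + 1) = -(1 / 2) := by
          rw [h0, h1] at hH
          linear_combination -hH
        have e2 := congrArg norm e
        rw [norm_pow] at e2
        have := one_le_pow₀ h2.le (n := m + 1)
        rw [e2] at this
        norm_num at this
      · exact key _ h1 h12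
    · exact key _ h0 h02
  -- By `h01`, `z₁` times the conjugate of `z₂` is real, so the two squares point in the same
  -- direction and their norms add.
  have e : ‖z 0‖ ^ 2 + ‖z 1‖ ^ 2 = ‖z 0 ^ 2 + z 1 ^ 2‖ := by
    have hi : (z 0).re * (z 1).im = (z 0).im * (z 1).re := by
      have := congrArg Complex.im h01
      simp at this
      linarith
    rw [← sq_eq_sq₀ (by positivity) (by positivity), Complex.sq_norm, Complex.sq_norm,
      Complex.sq_norm]
    simp only [Complex.normSq_apply, pow_two, Complex.add_re, Complex.add_im, Complex.mul_re,
      Complex.mul_im]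
    linear_combination 4 * ((z 0).re * (z 1).im - (z 0).im * (z 1).re) * hi
  have b : ‖z 2 ^ (m + 1) + 1 / 2‖ ≤ 1 + 1 / 2 := by
    refine (norm_add_le _ _).trans (add_le_add ?_ (by norm_num))
    rw [norm_pow]
    exact pow_le_one₀ (norm_nonneg _) hz2
  rw [EuclideanSpace.norm_sq_eq, Fin.sum_univ_three, e, hH]
  nlinarith [norm_nonneg (z 2)]

/-- The Liouville field of the standard primitive on `H` is half the orthogonal projection of
the radial field, and it increases the norm. -/
theorem exists_liouville {m : ℕ} (hm : 2 ≤ m) {z : Cn 3} (hz : z ∈ hypersurface m)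
    (h4 : 4 ≤ ‖z‖ ^ 2) (c : ℝ) :
    ∃ X ∈ hyperTangent m z, (∀ v ∈ hyperTangent m z, stdForm X v = stdPrimitive 3 z ![v]) ∧
      0 < fderiv ℝ (fun w : Cn 3 => ‖w‖ ^ 2 - c) z X := by
  set T := hyperTangent m z
  have hinner (v : Cn 3) (hv : v ∈ T) : inner ℂ (T.starProjection z) v = inner ℂ z v := by
    rw [Submodule.inner_starProjection_left_eq_right, Submodule.starProjection_eq_self_iff.2 hv]
  have hP : T.starProjection z ∈ T := Submodule.starProjection_apply_mem T z
  have hne : T.starProjection z ≠ 0 := by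
    intro h0
    refine (norm_sq_lt_of_mem_orthogonal_hyperTangent hm hz ?_).not_ge h4
    exact (Submodule.starProjection_apply_eq_zero_iff T).1 h0
  refine ⟨(1 / 2 : ℂ) • T.starProjection z, T.smul_mem _ hP, fun v hv => ?_, ?_⟩
  · rw [stdPrimitive_apply, stdForm_eq_im_inner, stdForm_eq_im_inner, inner_smul_left,
      hinner v hv]
    simp
    ring
  -- The derivative of `‖·‖²` along `X` equals the squared norm of the projection of `z`.
  · have hre (u v : Cn 3) : inner ℝ u v = (inner ℂ u v).re := by
      simp [PiLp.inner_apply, Complex.inner]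
    rw [fderiv_sub_const, fderiv_norm_sq_apply]
    have : inner ℂ z (T.starProjection z) = (‖T.starProjection z‖ : ℂ) ^ 2 := by
      rw [← hinner _ hP, inner_self_eq_norm_sq_to_K]
      rfl
    simp only [smul_apply, innerSL_apply_apply, hre, inner_smul_right, this]
    have h0 := norm_pos_iff.2 hne
    have e : (1 / 2 : ℂ) * (‖T.starProjection z‖ : ℂ) ^ 2 =
        ((1 / 2 * ‖T.starProjection z‖ ^ 2 : ℝ) : ℂ) := by push_cast; rfl
    rw [e, Complex.ofReal_re]
    positivity

theorem boundedDomain_eq {m : ℕ} {R : ℝ} (hR : 0 ≤ R) :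
    boundedDomain m R = {z | z ∈ hypersurface m ∧ ‖z‖ ^ 2 - R ^ 2 < 0} := by
  ext z
  simp only [boundedDomain, Set.mem_ofPred_eq, sub_neg, sq_lt_sq₀ (norm_nonneg z) hR]
  exact and_comm

/-- The polynomial and `‖·‖² - R²` are jointly submersive at `z`, since `X` is tangent to `H` and
raises the norm. So every neighbourhood of `z` attains the values `(0, b)` with small `b < 0`. -/
theorem mem_closure_boundedDomain {m : ℕ} (hm : 2 ≤ m) {R : ℝ} (hR : 2 ≤ R) {z : Cn 3}
    (hz : z ∈ hypersurface m) (hzR : ‖z‖ ^ 2 - R ^ 2 = 0) : z ∈ closure (boundedDomain m R) := by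
  obtain ⟨X, hX, -, hpos⟩ := exists_liouville hm hz (by nlinarith) (R ^ 2)
  set ρ : Cn 3 → ℝ := fun w => ‖w‖ ^ 2 - R ^ 2 with hρ
  have hρd : HasStrictFDerivAt ρ (fderiv ℝ ρ z) z := by
    have : ContDiff ℝ 1 ρ := (contDiff_norm_sq ℝ).sub contDiff_const
    exact this.contDiffAt.hasStrictFDerivAt one_ne_zero
  have hp : HasStrictFDerivAt (hyperPoly m) ((fderiv ℂ (hyperPoly m) z).restrictScalars ℝ) z := by
    have := hasStrictFDerivAt_hyperPoly m z
    rw [← this.hasFDerivAt.fderiv] at this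
    exact this.restrictScalars ℝ
  have hsurj : ((((fderiv ℂ (hyperPoly m) z).restrictScalars ℝ).prod (fderiv ℝ ρ z) :
      Cn 3 →L[ℝ] ℂ × ℝ) : Cn 3 →ₗ[ℝ] ℂ × ℝ).range = ⊤ := by
    rw [LinearMap.range_eq_top]
    rintro ⟨a, b⟩
    obtain ⟨v, hv⟩ : ∃ v, fderiv ℂ (hyperPoly m) z v = a :=
      LinearMap.surjective (f := (fderiv ℂ (hyperPoly m) z : Cn 3 →ₗ[ℂ] ℂ)) (fun h =>
        fderiv_hyperPoly_ne_zero hz (ContinuousLinearMap.coe_injective h)) a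
    have hX0 : fderiv ℂ (hyperPoly m) z X = 0 := hX
    refine ⟨v + ((b - fderiv ℝ ρ z v) / fderiv ℝ ρ z X) • X, Prod.ext ?_ ?_⟩
    · simp [hv, hX0]
    · simp
      field_simp
      ring
  have hmap := (hp.prodMk hρd).map_nhds_eq_of_surj hsurj
  rw [hyperPoly_eq_zero_iff.2 hz, show ρ z = 0 from hzR] at hmap
  rw [mem_closure_iff_nhds]
  intro t ht
  have h1 : (fun w => (hyperPoly m w, ρ w)) '' t ∈ nhds ((0 : ℂ), (0 : ℝ)) := by
    rw [← hmap]
    exact Filter.image_mem_map ht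
  have h2 : Filter.Tendsto (fun b : ℝ => ((0 : ℂ), b)) (nhdsWithin 0 (Set.Iio 0))
      (nhds ((0 : ℂ), (0 : ℝ))) :=
    (Continuous.prodMk_right (0 : ℂ)).continuousAt.tendsto.mono_left nhdsWithin_le_nhds
  obtain ⟨b, ⟨w, hwt, hw⟩, hb⟩ :=
    ((h2.eventually h1).and (eventually_mem_nhdsWithin (a := (0 : ℝ)) (s := Set.Iio 0))).exists
  refine ⟨w, hwt, ?_⟩
  rw [boundedDomain_eq (by linarith)]
  rw [Prod.mk.injEq] at hw
  exact ⟨hyperPoly_eq_zero_iff.1 hw.1, hw.2.trans_lt hb⟩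

theorem closure_boundedDomain {m : ℕ} (hm : 2 ≤ m) {R : ℝ} (hR : 2 ≤ R) :
    closure (boundedDomain m R) = {z | z ∈ hypersurface m ∧ ‖z‖ ^ 2 - R ^ 2 ≤ 0} := by
  refine subset_antisymm (closure_minimal ?_ ?_) ?_
  · rw [boundedDomain_eq (by linarith)]
    exact fun z hz => ⟨hz.1, hz.2.le⟩
  · exact (isClosed_hypersurface m).inter (isClosed_le
      (f := fun z : Cn 3 => ‖z‖ ^ 2 - R ^ 2) (by fun_prop) continuous_const)
  · rintro z ⟨hz, hzR⟩
    rcases hzR.lt_or_eq with h | h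
    · apply subset_closure
      rw [boundedDomain_eq (by linarith)]
      exact ⟨hz, h⟩
    · exact mem_closure_boundedDomain hm hR hz h

theorem isInteriorOfContactTypeDomain_boundedDomain {m : ℕ} (hm : 2 ≤ m) {R : ℝ} (hR : 2 ≤ R) :
    IsInteriorOfContactTypeDomain m (boundedDomain m R) := by
  have hL (z : Cn 3) (hz : z ∈ hypersurface m) (hzR : ‖z‖ ^ 2 - R ^ 2 = 0) :=
    exists_liouville hm hz (by nlinarith) (R ^ 2)
  refine ⟨?_, fun z => ‖z‖ ^ 2 - R ^ 2, (contDiff_norm_sq ℝ).sub contDiff_const,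
    boundedDomain_eq (by linarith), closure_boundedDomain hm hR, fun z hz hzR => ?_,
    Set.univ, stdPrimitive 3, isOpen_univ, Set.subset_univ _,
    (stdPrimitive 3).contDiff.contDiffOn, isPrimitiveOn_stdPrimitive m _, hL⟩
  · refine Metric.isCompact_of_isClosed_isBounded isClosed_closure (Bornology.IsBounded.closure ?_)
    exact (Metric.isBounded_ball (x := (0 : Cn 3)) (r := R)).subset fun z hz => by simpa using hz.1
  · obtain ⟨X, hX, -, hpos⟩ := hL z hz hzR
    exact ⟨X, hX, hpos.ne'⟩

/-! ### The winding of the loop `γ` -/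

/-- The values of `z₃ ^ (m + 1)` on a lift of the figure-eight map, in terms of `t₁`. -/
noncomputable def figureEightLoop (s : ℝ) : ℂ :=
  (1 - (s : ℂ) ^ 2) * (1 + Complex.I * s) ^ 2 - 1 / 2

theorem figureEightLoop_re (s : ℝ) : (figureEightLoop s).re = (1 - s ^ 2) ^ 2 - 1 / 2 := by
  simp [figureEightLoop, pow_two]

theorem figureEightLoop_im (s : ℝ) : (figureEightLoop s).im = 2 * s * (1 - s ^ 2) := by
  simp [figureEightLoop, pow_two]
  ring

/-- The imaginary part vanishes only at `s = 0, ±1`, where the real part is `±1/2`. -/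
theorem figureEightLoop_ne_zero (s : ℝ) : figureEightLoop s ≠ 0 := by
  intro h
  have hre := figureEightLoop_re s
  have him := figureEightLoop_im s
  rw [h, Complex.zero_re] at hre
  rw [h, Complex.zero_im] at him
  rcases mul_eq_zero.1 him.symm with h0 | h0
  · rw [show s = 0 by linarith] at hre
    norm_num at hre
  · rw [h0] at hre
    norm_num at hre

theorem contDiff_figureEightLoop : ContDiff ℝ ∞ figureEightLoop := by
  have : ContDiff ℝ ∞ fun s : ℝ => (s : ℂ) := Complex.ofRealCLM.contDiff
  unfold figureEightLoop
  fun_prop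

/-- A smooth nowhere vanishing complex function on the line has a smooth logarithm. -/
theorem exists_contDiff_log {g : ℝ → ℂ} (hg : ContDiff ℝ ∞ g) (h0 : ∀ s, g s ≠ 0) :
    ∃ L : ℝ → ℂ, ContDiff ℝ ∞ L ∧ ∀ s, Complex.exp (L s) = g s := by
  have hg' : ContDiff ℝ ∞ (deriv g) := (contDiff_infty_iff_deriv.1 hg).2
  have hq : ContDiff ℝ ∞ fun s => deriv g s / g s := by
    simp only [div_eq_mul_inv]
    exact hg'.mul (hg.inv h0)
  set L : ℝ → ℂ := fun u => Complex.log (g 0) + ∫ s in (0 : ℝ)..u, deriv g s / g s with hLdef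
  have hL (s : ℝ) : HasDerivAt L (deriv g s / g s) s :=
    (hq.continuous.integral_hasStrictDerivAt 0 s).hasDerivAt.const_add _
  have hd : deriv L = fun s => deriv g s / g s := funext fun s => (hL s).deriv
  refine ⟨L, contDiff_infty_iff_deriv.2 ⟨fun s => (hL s).differentiableAt, hd ▸ hq⟩, fun s => ?_⟩
  have hgd (s : ℝ) : HasDerivAt g (deriv g s) s :=
    ((contDiff_infty_iff_deriv.1 hg).1 s).hasDerivAt
  have hF (s : ℝ) : HasDerivAt (fun s => g s * Complex.exp (-L s)) 0 s := by
    refine ((hgd s).mul (hL s).neg.cexp).congr_deriv ?_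
    field_simp [h0 s]
    ring
  have hc := is_const_of_deriv_eq_zero (fun s => (hF s).differentiableAt)
    (fun s => (hF s).deriv) s 0
  have h1 : L 0 = Complex.log (g 0) := by simp [hLdef]
  simp only [h1, Complex.exp_neg, Complex.exp_log (h0 0), mul_inv_cancel₀ (h0 0)] at hc
  exact (mul_inv_eq_one₀ (Complex.exp_ne_zero _)).1 hc |>.symm

/-- On `[0, 1]` the path stays in the closed upper half-plane and runs from `1/2` to `-1/2`, so its
argument grows by exactly `π`. -/
theorem log_figureEightLoop_one {L : ℝ → ℂ} (hL : Continuous L)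
    (hexp : ∀ s, Complex.exp (L s) = figureEightLoop s) : L 1 = L 0 + Real.pi * Complex.I := by
  have h0 : figureEightLoop 0 = 1 / 2 := by norm_num [figureEightLoop]
  have h1 : figureEightLoop 1 = -(1 / 2) := by norm_num [figureEightLoop]
  have hK (s : ℝ) : Complex.exp (L s - L 0) = 2 * figureEightLoop s := by
    rw [Complex.exp_sub, hexp, hexp, h0]
    ring
  have hsin (s : ℝ) (hs : s ∈ Set.uIcc (0 : ℝ) 1) : 0 ≤ Real.sin (L s - L 0).im := by
    have him := congrArg Complex.im (hK s)
    rw [Complex.exp_im, Complex.mul_im, figureEightLoop_im] at him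
    simp only [Complex.re_ofNat, Complex.im_ofNat, zero_mul, add_zero] at him
    rw [Set.uIcc_of_le zero_le_one] at hs
    have : 0 ≤ Real.exp (L s - L 0).re * Real.sin (L s - L 0).im := by
      rw [him]
      have : 0 ≤ 1 - s ^ 2 := by nlinarith [hs.1, hs.2]
      have := hs.1
      positivity
    exact nonneg_of_mul_nonneg_right this (Real.exp_pos _)
  -- Every angle between the initial and final ones is attained, so its sine is nonnegative.
  have hivt (y : ℝ) (hy : y ∈ Set.uIcc 0 (L 1 - L 0).im) : 0 ≤ Real.sin y := by
    have hc : ContinuousOn (fun s => (L s - L 0).im) (Set.uIcc 0 1) :=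
      (Complex.continuous_im.comp (hL.sub continuous_const)).continuousOn
    have := intermediate_value_uIcc hc
    simp only [sub_self, Complex.zero_im] at this
    obtain ⟨s, hs, rfl⟩ := this hy
    exact hsin s hs
  obtain ⟨n, hn⟩ : ∃ n : ℤ, L 1 - L 0 = Real.pi * Complex.I + n * (2 * Real.pi * Complex.I) := by
    rw [← Complex.exp_eq_exp_iff_exists_int, hK, h1, Complex.exp_pi_mul_I]
    norm_num
  have him : (L 1 - L 0).im = Real.pi + n * (2 * Real.pi) := by
    rw [hn]
    simp
  have hpi := Real.pi_pos
  have hn0 : n = 0 := by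
    -- A further full turn would sweep through `-π/2` or `3π/2`, where the sine is `-1`.
    by_contra hne
    rcases lt_or_gt_of_ne hne with h | h
    · have hn1 : (n : ℝ) ≤ -1 := by exact_mod_cast Int.le_sub_one_of_lt h
      have := hivt (-(Real.pi / 2)) (by
        rw [Set.mem_uIcc, him]
        right
        constructor <;> nlinarith)
      rw [Real.sin_neg, Real.sin_pi_div_two] at this
      linarith
    · have hn1 : (1 : ℝ) ≤ n := by exact_mod_cast h
      have := hivt (Real.pi / 2 + Real.pi) (by
        rw [Set.mem_uIcc, him]
        left
        constructor <;> nlinarith)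
      rw [Real.sin_add_pi, Real.sin_pi_div_two] at this
      linarith
  rw [hn0] at hn
  simp only [Int.cast_zero, zero_mul, add_zero] at hn
  linear_combination hn

theorem conj_figureEightLoop_neg (s : ℝ) :
    (starRingEnd ℂ) (figureEightLoop (-s)) = figureEightLoop s := by
  apply Complex.ext
  · rw [Complex.conj_re, figureEightLoop_re, figureEightLoop_re]
    ring
  · rw [Complex.conj_im, figureEightLoop_im, figureEightLoop_im]
    ring

/-- The loop traced by `figureEightLoop` winds once around the origin. -/
theorem log_figureEightLoop_sub {L : ℝ → ℂ} (hL : Continuous L)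
    (hexp : ∀ s, Complex.exp (L s) = figureEightLoop s) :
    L 1 - L (-1) = 2 * Real.pi * Complex.I := by
  have h1 := log_figureEightLoop_one hL hexp
  -- The symmetry of `γ` under `s ↦ -s` and conjugation turns the half-turn on `[0, 1]` into one on
  -- `[-1, 0]`.
  have h2 := log_figureEightLoop_one (L := fun s => (starRingEnd ℂ) (L (-s)))
    (Complex.continuous_conj.comp (hL.comp continuous_neg))
    fun s => by rw [Complex.exp_conj, hexp, conj_figureEightLoop_neg]
  have h3 := congrArg (starRingEnd ℂ) h2
  simp only [map_add, map_mul, Complex.conj_conj, Complex.conj_I, Complex.conj_ofReal,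
    neg_zero] at h3
  linear_combination h1 - h3

theorem exists_log_figureEightLoop : ∃ L : ℝ → ℂ, ContDiff ℝ ∞ L ∧
    (∀ s, Complex.exp (L s) = figureEightLoop s) ∧ L 1 - L (-1) = 2 * Real.pi * Complex.I := by
  obtain ⟨L, hL, h⟩ := exists_contDiff_log contDiff_figureEightLoop figureEightLoop_ne_zero
  exact ⟨L, hL, h, log_figureEightLoop_sub hL.continuous h⟩

/-! ### The figure-eight map and its graphs -/

theorem contMDiff_comp_coe_sphere {F : Type*} [NormedAddCommGroup F] [NormedSpace ℝ F]
    {φ : EuclideanSpace ℝ (Fin 3) → F} (hφ : ContDiff ℝ ∞ φ) :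
    ContMDiff (𝓡 2) 𝓘(ℝ, F) ∞ fun t : S2 => φ t :=
  hφ.contMDiff.comp contMDiff_coe_sphere

/-- The inclusion of the tangent space of the unit sphere into the ambient space. -/
noncomputable def sphereTangentIncl (t : S2) : TangentSpace (𝓡 2) t →L[ℝ] EuclideanSpace ℝ (Fin 3) :=
  mvfderiv (𝓡 2) (Subtype.val : S2 → EuclideanSpace ℝ (Fin 3)) t

theorem mfderiv_comp_coe_sphere {F : Type*} [NormedAddCommGroup F] [NormedSpace ℝ F]
    {φ : EuclideanSpace ℝ (Fin 3) → F} (hφ : ContDiff ℝ ∞ φ) (t : S2)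
    (u : TangentSpace (𝓡 2) t) :
    mfderiv (𝓡 2) 𝓘(ℝ, F) (fun t : S2 => φ t) t u = fderiv ℝ φ t (sphereTangentIncl t u) := by
  have h1 : MDifferentiableAt 𝓘(ℝ, EuclideanSpace ℝ (Fin 3)) 𝓘(ℝ, F) φ (t : EuclideanSpace ℝ (Fin 3)) :=
    (hφ.differentiable (by simp)).differentiableAt.mdifferentiableAt
  have h2 : MDifferentiableAt (𝓡 2) 𝓘(ℝ, EuclideanSpace ℝ (Fin 3))
      (Subtype.val : S2 → EuclideanSpace ℝ (Fin 3)) t :=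
    (contMDiff_coe_sphere (m := 1)).mdifferentiable one_ne_zero t
  have := mfderiv_comp t h1 h2
  rw [mfderiv_eq_fderiv] at this
  exact congrArg (fun A => A u) this

theorem injective_sphereTangentIncl (t : S2) : Function.Injective (sphereTangentIncl t) :=
  injective_mvfderiv_subtypeVal_sphere t

theorem mem_range_sphereTangentIncl {t : S2} {v : EuclideanSpace ℝ (Fin 3)} :
    (∃ u, sphereTangentIncl t u = v) ↔ inner ℝ (t : EuclideanSpace ℝ (Fin 3)) v = 0 := by
  rw [← Submodule.mem_orthogonal_singleton_iff_inner_right, ← range_mvfderiv_subtypeVal (n := 2)]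
  rfl

/-- A coordinate of the figure-eight map, on the ambient space of the sphere. -/
noncomputable def figureEightCoord (j : Fin 3) (x : EuclideanSpace ℝ (Fin 3)) : ℂ :=
  (x j : ℂ) * (1 + Complex.I * (x 0 : ℂ))

/-- The figure-eight map on the ambient space of the sphere. -/
noncomputable def figureEightExt (x : EuclideanSpace ℝ (Fin 3)) : Cn 2 :=
  !₂[figureEightCoord 1 x, figureEightCoord 2 x]

/-- The figure-eight map with a function of the first variable as a third coordinate. -/
noncomputable def figureEightGraph (h : ℝ → ℂ) (x : EuclideanSpace ℝ (Fin 3)) : Cn 3 :=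
  !₂[figureEightCoord 1 x, figureEightCoord 2 x, h (x 0)]

theorem contDiff_figureEightCoord (j : Fin 3) : ContDiff ℝ ∞ (figureEightCoord j) := by
  have h (j : Fin 3) : ContDiff ℝ ∞ fun x : EuclideanSpace ℝ (Fin 3) => (x j : ℂ) :=
    Complex.ofRealCLM.contDiff.comp (EuclideanSpace.proj (𝕜 := ℝ) j).contDiff
  exact (h j).mul (contDiff_const.add (contDiff_const.mul (h 0)))

theorem contDiff_figureEightExt : ContDiff ℝ ∞ figureEightExt := by
  rw [contDiff_piLp]
  intro i
  fin_cases i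
  exacts [contDiff_figureEightCoord 1, contDiff_figureEightCoord 2]

theorem contDiff_figureEightGraph {h : ℝ → ℂ} (hh : ContDiff ℝ ∞ h) :
    ContDiff ℝ ∞ (figureEightGraph h) := by
  rw [contDiff_piLp]
  intro i
  fin_cases i
  exacts [contDiff_figureEightCoord 1, contDiff_figureEightCoord 2,
    hh.comp (EuclideanSpace.proj (𝕜 := ℝ) (0 : Fin 3)).contDiff]

theorem fderiv_figureEightCoord (j : Fin 3) (x v : EuclideanSpace ℝ (Fin 3)) :
    fderiv ℝ (figureEightCoord j) x v =
      v j * (1 + Complex.I * x 0) + x j * (Complex.I * v 0) := by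
  have h (j : Fin 3) : HasFDerivAt (fun x : EuclideanSpace ℝ (Fin 3) => (x j : ℂ))
      (Complex.ofRealCLM ∘L EuclideanSpace.proj (𝕜 := ℝ) j) x :=
    Complex.ofRealCLM.hasFDerivAt.comp x (EuclideanSpace.proj (𝕜 := ℝ) j).hasFDerivAt
  have := (h j).mul (((h 0).const_mul Complex.I).const_add 1)
  refine (congrArg (fun A => A v) this.fderiv).trans ?_
  simp
  ring

theorem fderiv_piLp_apply {ι : Type*} [Fintype ι] {E : Type*} [NormedAddCommGroup E]
    [NormedSpace ℝ E] {φ : E → EuclideanSpace ℂ ι} {x : E} (hφ : DifferentiableAt ℝ φ x) (v : E)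
    (i : ι) : fderiv ℝ φ x v i = fderiv ℝ (fun y => φ y i) x v := by
  have := (PiLp.proj (𝕜 := ℝ) 2 (fun _ : ι => ℂ) i).hasFDerivAt.comp x hφ.hasFDerivAt
  exact (congrArg (fun A => A v) this.fderiv).symm

theorem fderiv_figureEightExt_apply (x v : EuclideanSpace ℝ (Fin 3)) (i : Fin 2) :
    fderiv ℝ figureEightExt x v i =
      v i.succ * (1 + Complex.I * x 0) + x i.succ * (Complex.I * v 0) := by
  rw [fderiv_piLp_apply (contDiff_figureEightExt.differentiable (by simp)).differentiableAt]
  fin_cases i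
  exacts [fderiv_figureEightCoord 1 x v, fderiv_figureEightCoord 2 x v]

theorem fderiv_figureEightGraph_castSucc {h : ℝ → ℂ} (hh : ContDiff ℝ ∞ h)
    (x v : EuclideanSpace ℝ (Fin 3)) (i : Fin 2) :
    fderiv ℝ (figureEightGraph h) x v i.castSucc =
      v i.succ * (1 + Complex.I * x 0) + x i.succ * (Complex.I * v 0) := by
  rw [fderiv_piLp_apply ((contDiff_figureEightGraph hh).differentiable (by simp)).differentiableAt]
  fin_cases i
  exacts [fderiv_figureEightCoord 1 x v, fderiv_figureEightCoord 2 x v]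

theorem fderiv_figureEightGraph_two {h : ℝ → ℂ} (hh : ContDiff ℝ ∞ h)
    (x v : EuclideanSpace ℝ (Fin 3)) :
    fderiv ℝ (figureEightGraph h) x v 2 = v 0 * deriv h (x 0) := by
  rw [fderiv_piLp_apply ((contDiff_figureEightGraph hh).differentiable (by simp)).differentiableAt]
  have h1 := ((contDiff_infty_iff_deriv.1 hh).1 (x 0)).hasDerivAt.hasFDerivAt
  have h2 := h1.comp x (EuclideanSpace.proj (𝕜 := ℝ) (0 : Fin 3)).hasFDerivAt
  refine (congrArg (fun A => A v) h2.fderiv).trans ?_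
  simp

theorem sum_mul_eq_zero (t : S2) (u : TangentSpace (𝓡 2) t) :
    ∑ j, (t : EuclideanSpace ℝ (Fin 3)) j * sphereTangentIncl t u j = 0 := by
  have := mem_range_sphereTangentIncl.1 ⟨u, rfl⟩
  rw [PiLp.inner_apply] at this
  simpa [mul_comm] using this

theorem sum_sq_eq_one (t : S2) : ∑ j, (t : EuclideanSpace ℝ (Fin 3)) j ^ 2 = 1 := by
  have : ‖(t : EuclideanSpace ℝ (Fin 3))‖ ^ 2 = 1 := by
    rw [norm_eq_of_mem_sphere]
    norm_num
  rw [EuclideanSpace.norm_sq_eq] at this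
  simpa using this

/-- Real parts kill `u₂, u₃`; imaginary parts and tangency then give `tⱼ u₁ = 0` for all `j`, while
`|t| = 1`. No third coordinate is needed, so this serves both `f` and its lifts. -/
theorem eq_zero_of_figureEight_derivative {t : S2} {u : TangentSpace (𝓡 2) t}
    (h : ∀ i : Fin 2, (sphereTangentIncl t u i.succ : ℂ) *
        (1 + Complex.I * (t : EuclideanSpace ℝ (Fin 3)) 0) +
      (t : EuclideanSpace ℝ (Fin 3)) i.succ * (Complex.I * sphereTangentIncl t u 0) = 0) :
    u = 0 := by
  have hs := sum_mul_eq_zero t u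
  have h1 := sum_sq_eq_one t
  have hre (i : Fin 2) : sphereTangentIncl t u i.succ = 0 := by
    simpa using congrArg Complex.re (h i)
  have him (i : Fin 2) :
      (t : EuclideanSpace ℝ (Fin 3)) i.succ * sphereTangentIncl t u 0 = 0 := by
    simpa [hre i] using congrArg Complex.im (h i)
  apply injective_sphereTangentIncl t
  rw [map_zero]
  simp only [Fin.sum_univ_succ, hre, mul_zero, add_zero, Finset.sum_const_zero] at hs
  have h0 : sphereTangentIncl t u 0 = 0 := by
    have e : sphereTangentIncl t u 0 * ∑ j, (t : EuclideanSpace ℝ (Fin 3)) j ^ 2 = 0 := by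
      rw [Fin.sum_univ_succ, Fin.sum_univ_two]
      linear_combination (t : EuclideanSpace ℝ (Fin 3)) 0 * hs +
        (t : EuclideanSpace ℝ (Fin 3)) (Fin.succ 0) * him 0 +
        (t : EuclideanSpace ℝ (Fin 3)) (Fin.succ 1) * him 1
    rwa [h1, mul_one] at e
  ext j
  induction j using Fin.cases with
  | zero => exact h0
  | succ i => exact hre i

/-- The form reduces to `∑ tⱼ (uⱼ v₁ - u₁ vⱼ)` over `j = 2, 3`, which tangency to the sphere
cancels. -/
theorem figureEight_isotropic (t : S2) (u v : TangentSpace (𝓡 2) t) :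
    stdForm (fderiv ℝ figureEightExt t (sphereTangentIncl t u))
      (fderiv ℝ figureEightExt t (sphereTangentIncl t v)) = 0 := by
  have hu := sum_mul_eq_zero t u
  have hv := sum_mul_eq_zero t v
  simp only [Fin.sum_univ_succ, Finset.univ_unique, Finset.sum_singleton, Fin.default_eq_zero] at hu hv
  simp only [stdForm, fderiv_figureEightExt_apply, Fin.sum_univ_two]
  simp
  simp at hu hv
  linear_combination sphereTangentIncl t v 0 * hu - sphereTangentIncl t u 0 * hv

theorem isIsotropicImmersion_figureEight : IsIsotropicImmersion figureEight where
  smooth := contMDiff_comp_coe_sphere contDiff_figureEightExt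
  immersion t := by
    refine (injective_iff_map_eq_zero _).2 fun u hu => eq_zero_of_figureEight_derivative fun i => ?_
    have := mfderiv_comp_coe_sphere contDiff_figureEightExt t u
    rw [← fderiv_figureEightExt_apply, ← this]
    exact congrArg (fun w : Cn 2 => w i) hu
  isotropic t u v := by
    have hu := mfderiv_comp_coe_sphere contDiff_figureEightExt t u
    have hv := mfderiv_comp_coe_sphere contDiff_figureEightExt t v
    rw [← figureEight_isotropic t u v, ← hu, ← hv]
    rfl

theorem isIsotropicImmersion_figureEightGraph {h : ℝ → ℂ} (hh : ContDiff ℝ ∞ h) :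
    IsIsotropicImmersion fun t : S2 => figureEightGraph h t where
  smooth := contMDiff_comp_coe_sphere (contDiff_figureEightGraph hh)
  immersion t := by
    refine (injective_iff_map_eq_zero _).2 fun u hu => eq_zero_of_figureEight_derivative fun i => ?_
    have := mfderiv_comp_coe_sphere (contDiff_figureEightGraph hh) t u
    rw [← fderiv_figureEightGraph_castSucc hh, ← this]
    exact congrArg (fun w : Cn 3 => w i.castSucc) hu
  isotropic t u v := by
    rw [mfderiv_comp_coe_sphere (contDiff_figureEightGraph hh),
      mfderiv_comp_coe_sphere (contDiff_figureEightGraph hh)]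
    have := figureEight_isotropic t u v
    simp only [stdForm, fderiv_figureEightExt_apply] at this
    rw [stdForm, Fin.sum_univ_castSucc]
    simp only [fderiv_figureEightGraph_castSucc hh]
    rw [this, show Fin.last 2 = 2 from rfl]
    -- Both third components are real multiples of `h'`, so they contribute nothing.
    simp only [fderiv_figureEightGraph_two hh]
    simp
    ring

theorem eq_zero_of_sq_eq_one {t : S2} (h : (t : EuclideanSpace ℝ (Fin 3)) 0 ^ 2 = 1) :
    (t : EuclideanSpace ℝ (Fin 3)) 1 = 0 ∧ (t : EuclideanSpace ℝ (Fin 3)) 2 = 0 := by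
  have := sum_sq_eq_one t
  rw [Fin.sum_univ_three, h] at this
  constructor <;> nlinarith [sq_nonneg ((t : EuclideanSpace ℝ (Fin 3)) 1),
    sq_nonneg ((t : EuclideanSpace ℝ (Fin 3)) 2)]

/-- The figure-eight map identifies only the two poles. -/
theorem eq_or_of_figureEightCoord_eq {s t : S2} (h1 : figureEightCoord 1 s = figureEightCoord 1 t)
    (h2 : figureEightCoord 2 s = figureEightCoord 2 t) :
    s = t ∨ ((s : EuclideanSpace ℝ (Fin 3)) 0 = 1 ∧ (t : EuclideanSpace ℝ (Fin 3)) 0 = -1) ∨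
      ((s : EuclideanSpace ℝ (Fin 3)) 0 = -1 ∧ (t : EuclideanSpace ℝ (Fin 3)) 0 = 1) := by
  have r1 := congrArg Complex.re h1
  have r2 := congrArg Complex.re h2
  have i1 := congrArg Complex.im h1
  have i2 := congrArg Complex.im h2
  simp [figureEightCoord] at r1 r2 i1 i2
  have hs := sum_sq_eq_one s
  have ht := sum_sq_eq_one t
  rw [Fin.sum_univ_three] at hs ht
  have ext0 (h0 : (s : EuclideanSpace ℝ (Fin 3)) 0 = (t : EuclideanSpace ℝ (Fin 3)) 0) : s = t := by
    apply Subtype.ext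
    ext j
    fin_cases j
    exacts [h0, r1, r2]
  rw [r1] at i1
  rw [r2] at i2
  -- The imaginary parts `tⱼ t₁` recover `t₁` unless `t₂ = t₃ = 0`.
  by_cases z1 : (t : EuclideanSpace ℝ (Fin 3)) 1 = 0
  · by_cases z2 : (t : EuclideanSpace ℝ (Fin 3)) 2 = 0
    · rw [r1, r2, z1, z2] at hs
      rw [z1, z2] at ht
      have hs' : (s : EuclideanSpace ℝ (Fin 3)) 0 ^ 2 = 1 := by linarith
      have ht' : (t : EuclideanSpace ℝ (Fin 3)) 0 ^ 2 = 1 := by linarith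
      rcases eq_or_eq_neg_of_sq_eq_sq _ 1 (hs'.trans (one_pow 2).symm) with a | a <;>
        rcases eq_or_eq_neg_of_sq_eq_sq _ 1 (ht'.trans (one_pow 2).symm) with b | b
      exacts [Or.inl (ext0 (a.trans b.symm)), Or.inr (Or.inl ⟨a, b⟩), Or.inr (Or.inr ⟨a, b⟩),
        Or.inl (ext0 (a.trans b.symm))]
    · exact Or.inl (ext0 (mul_left_cancel₀ z2 i2))
  · exact Or.inl (ext0 (mul_left_cancel₀ z1 i1))

/-- Reduces the lifting problem to extracting a root of a function of `t₁` alone. -/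
theorem figureEightCoord_sq_add_sq (t : S2) :
    figureEightCoord 1 t ^ 2 + figureEightCoord 2 t ^ 2 =
      figureEightLoop ((t : EuclideanSpace ℝ (Fin 3)) 0) + 1 / 2 := by
  have h : ((∑ j, (t : EuclideanSpace ℝ (Fin 3)) j ^ 2 : ℝ) : ℂ) = (1 : ℝ) := by
    rw [sum_sq_eq_one]
  rw [Fin.sum_univ_three] at h
  push_cast at h
  simp only [figureEightCoord, figureEightLoop]
  linear_combination (1 + Complex.I * (t : EuclideanSpace ℝ (Fin 3)) 0) ^ 2 * h

/-! ### Tangent planes at the poles -/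

theorem mem_sphereTangent_figureEightGraph {h : ℝ → ℂ} (hh : ContDiff ℝ ∞ h) {t : S2} {w : Cn 3} :
    w ∈ sphereTangent (fun t : S2 => figureEightGraph h t) t ↔
      ∃ v : EuclideanSpace ℝ (Fin 3), inner ℝ (t : EuclideanSpace ℝ (Fin 3)) v = 0 ∧
        fderiv ℝ (figureEightGraph h) t v = w := by
  constructor
  · rintro ⟨u, rfl⟩
    exact ⟨sphereTangentIncl t u, mem_range_sphereTangentIncl.1 ⟨u, rfl⟩,
      (mfderiv_comp_coe_sphere (contDiff_figureEightGraph hh) t u).symm⟩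
  · rintro ⟨v, hv, rfl⟩
    obtain ⟨u, rfl⟩ := mem_range_sphereTangentIncl.2 hv
    exact ⟨u, mfderiv_comp_coe_sphere (contDiff_figureEightGraph hh) t u⟩

theorem mem_sphereTangent_pole {h : ℝ → ℂ} (hh : ContDiff ℝ ∞ h) {t : S2}
    (ht : (t : EuclideanSpace ℝ (Fin 3)) 0 ^ 2 = 1) {w : Cn 3} :
    w ∈ sphereTangent (fun t : S2 => figureEightGraph h t) t ↔
      ∃ a b : ℝ, w = !₂[a * (1 + Complex.I * (t : EuclideanSpace ℝ (Fin 3)) 0),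
        b * (1 + Complex.I * (t : EuclideanSpace ℝ (Fin 3)) 0), 0] := by
  obtain ⟨h1, h2⟩ := eq_zero_of_sq_eq_one ht
  have hne : (t : EuclideanSpace ℝ (Fin 3)) 0 ≠ 0 := fun h0 => by simp [h0] at ht
  have hd (v : EuclideanSpace ℝ (Fin 3)) (hv : v 0 = 0) : fderiv ℝ (figureEightGraph h) t v =
      !₂[v 1 * (1 + Complex.I * (t : EuclideanSpace ℝ (Fin 3)) 0),
        v 2 * (1 + Complex.I * (t : EuclideanSpace ℝ (Fin 3)) 0), 0] := by
    ext j
    fin_cases j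
    · simpa [hv] using fderiv_figureEightGraph_castSucc hh t v 0
    · simpa [hv] using fderiv_figureEightGraph_castSucc hh t v 1
    · simpa [hv] using fderiv_figureEightGraph_two hh t v
  have hin (v : EuclideanSpace ℝ (Fin 3)) :
      inner ℝ (t : EuclideanSpace ℝ (Fin 3)) v = 0 ↔ v 0 = 0 := by
    rw [PiLp.inner_apply, Fin.sum_univ_three, h1, h2]
    simp [hne]
  rw [mem_sphereTangent_figureEightGraph hh]
  constructor
  · rintro ⟨v, hv, rfl⟩
    exact ⟨v 1, v 2, hd v ((hin v).1 hv)⟩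
  · rintro ⟨a, b, rfl⟩
    exact ⟨!₂[0, a, b], (hin _).2 rfl, hd _ rfl⟩

/-- At a pole the gradient has only its third entry, so the tangent space of `H` is `ℂ² × 0`, the
sum of `(1 + i)ℝ²` and `(1 - i)ℝ²`. -/
theorem sphereTangent_sup_pole {m : ℕ} {h h' : ℝ → ℂ} (hh : ContDiff ℝ ∞ h)
    (hh' : ContDiff ℝ ∞ h') (hne : ∀ x, h x ≠ 0) {s t : S2}
    (hs : (s : EuclideanSpace ℝ (Fin 3)) 0 ^ 2 = 1)
    (hst : (t : EuclideanSpace ℝ (Fin 3)) 0 = -(s : EuclideanSpace ℝ (Fin 3)) 0) :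
    sphereTangent (fun t : S2 => figureEightGraph h t) s ⊔
      sphereTangent (fun t : S2 => figureEightGraph h' t) t =
        (hyperTangent m (figureEightGraph h s)).restrictScalars ℝ := by
  have ht : (t : EuclideanSpace ℝ (Fin 3)) 0 ^ 2 = 1 := by rw [hst, neg_sq, hs]
  obtain ⟨h1, h2⟩ := eq_zero_of_sq_eq_one hs
  have hT (w : Cn 3) : w ∈ (hyperTangent m (figureEightGraph h s)).restrictScalars ℝ ↔ w 2 = 0 := by
    rw [Submodule.restrictScalars_mem, mem_hyperTangent_iff]
    have hm : (m : ℂ) + 1 ≠ 0 := by exact_mod_cast m.succ_ne_zero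
    simp [Fin.sum_univ_three, hyperGrad, figureEightGraph, figureEightCoord, h1, h2, hne, hm]
  ext w
  rw [Submodule.mem_sup, hT]
  constructor
  · rintro ⟨y, hy, z, hz, rfl⟩
    obtain ⟨a, b, rfl⟩ := (mem_sphereTangent_pole hh hs).1 hy
    obtain ⟨a, b, rfl⟩ := (mem_sphereTangent_pole hh' ht).1 hz
    simp
  · intro hw
    set ε := (s : EuclideanSpace ℝ (Fin 3)) 0
    -- The coefficients solve `a(1 + iε) + b(1 - iε) = w` in each coordinate, using `ε² = 1`.
    refine ⟨_, (mem_sphereTangent_pole hh hs).2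
        ⟨((w 0).re + ε * (w 0).im) / 2, ((w 1).re + ε * (w 1).im) / 2, rfl⟩,
      _, (mem_sphereTangent_pole hh' ht).2
        ⟨((w 0).re - ε * (w 0).im) / 2, ((w 1).re - ε * (w 1).im) / 2, rfl⟩, ?_⟩
    rw [hst]
    have hε : (ε : ℂ) ^ 2 = 1 := by rw [← Complex.ofReal_pow, hs, Complex.ofReal_one]
    ext j
    fin_cases j
    · simp
      linear_combination (Complex.I * (w 0).im) * hε + Complex.re_add_im (w 0)
    · simp
      linear_combination (Complex.I * (w 1).im) * hε + Complex.re_add_im (w 1)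
    · simp [hw]

/-! ### Intersections of the deck translates -/

/-- The generator of the group of `(m + 1)`-st roots of unity. -/
noncomputable def deckRoot (m : ℕ) : ℂ := Complex.exp (2 * Real.pi * Complex.I / (m + 1))

theorem isPrimitiveRoot_deckRoot (m : ℕ) : IsPrimitiveRoot (deckRoot m) (m + 1) := by
  have := Complex.isPrimitiveRoot_exp (m + 1) m.succ_ne_zero
  push_cast at this
  exact this

/-- The intersections of the translates of a lifted figure-eight sphere. -/
theorem figureEightGraph_eq_cases {m : ℕ} {h : ℝ → ℂ} (h0 : ∀ x, h x ≠ 0)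
    (hend : h 1 = deckRoot m * h (-1)) {i j : ℕ} (hi : i < m) (hj : j < m) {s t : S2}
    (hst : figureEightGraph (fun x => deckRoot m ^ i * h x) s =
      figureEightGraph (fun x => deckRoot m ^ j * h x) t) :
    (s = t ∧ i = j) ∨ ((s : EuclideanSpace ℝ (Fin 3)) 0 = 1 ∧
        (t : EuclideanSpace ℝ (Fin 3)) 0 = -1 ∧ i + 1 = j) ∨
      ((s : EuclideanSpace ℝ (Fin 3)) 0 = -1 ∧ (t : EuclideanSpace ℝ (Fin 3)) 0 = 1 ∧
        j + 1 = i) := by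
  have hζ := isPrimitiveRoot_deckRoot m
  have e0 : figureEightCoord 1 s = figureEightCoord 1 t := congrArg (fun w : Cn 3 => w 0) hst
  have e1 : figureEightCoord 2 s = figureEightCoord 2 t := congrArg (fun w : Cn 3 => w 1) hst
  have e2 : deckRoot m ^ i * h ((s : EuclideanSpace ℝ (Fin 3)) 0) =
    deckRoot m ^ j * h ((t : EuclideanSpace ℝ (Fin 3)) 0) := congrArg (fun w : Cn 3 => w 2) hst
  rcases eq_or_of_figureEightCoord_eq e0 e1 with rfl | ⟨hs, ht⟩ | ⟨hs, ht⟩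
  · exact Or.inl ⟨rfl, hζ.pow_inj (by lia) (by lia) (mul_right_cancel₀ (h0 _) e2)⟩
  -- Here `ζ^(i+1) = ζ^j`, and `i + 1 ≤ m` stays below the order `m + 1`, so the exponents agree.
  -- One more translate would close the chain into a cycle.
  · refine Or.inr (Or.inl ⟨hs, ht, hζ.pow_inj (by lia) (by lia) (mul_right_cancel₀ (h0 (-1)) ?_)⟩)
    rw [hs, ht, hend] at e2
    linear_combination e2
  · refine Or.inr (Or.inr ⟨hs, ht, hζ.pow_inj (by lia) (by lia) (mul_right_cancel₀ (h0 (-1)) ?_)⟩)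
    rw [hs, ht, hend] at e2
    linear_combination -e2

theorem figureEightGraph_mem_hypersurface {m : ℕ} {h : ℝ → ℂ}
    (hpow : ∀ x, h x ^ (m + 1) = figureEightLoop x) (i : ℕ) (t : S2) :
    figureEightGraph (fun x => deckRoot m ^ i * h x) t ∈ hypersurface m := by
  have e : (deckRoot m ^ i * h ((t : EuclideanSpace ℝ (Fin 3)) 0)) ^ (m + 1) =
      figureEightLoop ((t : EuclideanSpace ℝ (Fin 3)) 0) := by
    rw [mul_pow, pow_right_comm, (isPrimitiveRoot_deckRoot m).pow_eq_one, one_pow, one_mul, hpow]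
  have := figureEightCoord_sq_add_sq t
  rw [← e] at this
  exact this

theorem figureEightGraph_pole (h : ℝ → ℂ) {t : S2}
    (ht : (t : EuclideanSpace ℝ (Fin 3)) 0 ^ 2 = 1) :
    figureEightGraph h t = !₂[0, 0, h ((t : EuclideanSpace ℝ (Fin 3)) 0)] := by
  obtain ⟨h1, h2⟩ := eq_zero_of_sq_eq_one ht
  simp [figureEightGraph, figureEightCoord, h1, h2]

theorem exists_pole {ε : ℝ} (hε : ε ^ 2 = 1) :
    ∃ t : S2, (t : EuclideanSpace ℝ (Fin 3)) 0 = ε := by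
  refine ⟨⟨!₂[ε, 0, 0], ?_⟩, rfl⟩
  rw [mem_sphere_zero_iff_norm, EuclideanSpace.norm_eq]
  simp [Fin.sum_univ_three, hε]

theorem range_inter_range_eq_singleton {m : ℕ} {h : ℝ → ℂ} (h0 : ∀ x, h x ≠ 0)
    (hend : h 1 = deckRoot m * h (-1)) {i : ℕ} (hi : i + 1 < m) :
    (Set.range fun t : S2 => figureEightGraph (fun x => deckRoot m ^ i * h x) t) ∩
      (Set.range fun t : S2 => figureEightGraph (fun x => deckRoot m ^ (i + 1) * h x) t) =
        {!₂[0, 0, deckRoot m ^ i * h 1]} := by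
  ext w
  rw [Set.mem_singleton_iff]
  constructor
  · rintro ⟨⟨s, rfl⟩, ⟨t, hst⟩⟩
    rcases figureEightGraph_eq_cases h0 hend (by lia) hi hst.symm with ⟨-, h⟩ | ⟨hs, -⟩ | ⟨-, -, h⟩
    · lia
    · beta_reduce
      rw [figureEightGraph_pole _ (by rw [hs]; norm_num), hs]
    · lia
  · rintro rfl
    obtain ⟨s, hs⟩ := exists_pole (ε := 1) (by norm_num)
    obtain ⟨t, ht⟩ := exists_pole (ε := -1) (by norm_num)
    refine ⟨⟨s, ?_⟩, ⟨t, ?_⟩⟩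
    · beta_reduce
      rw [figureEightGraph_pole _ (by rw [hs]; norm_num), hs]
    · beta_reduce
      rw [figureEightGraph_pole _ (by rw [ht]; norm_num), ht, hend, pow_succ, mul_assoc]

theorem isAConfiguration_figureEightGraph {m : ℕ} {h : ℝ → ℂ} (hh : ContDiff ℝ ∞ h)
    (h0 : ∀ x, h x ≠ 0) (hpow : ∀ x, h x ^ (m + 1) = figureEightLoop x)
    (hend : h 1 = deckRoot m * h (-1)) :
    IsAConfiguration m (hypersurface m) fun (k : Fin m) (t : S2) =>
      figureEightGraph (fun x => deckRoot m ^ (k : ℕ) * h x) t := by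
  have hsm (i : ℕ) : ContDiff ℝ ∞ fun x => deckRoot m ^ i * h x := contDiff_const.mul hh
  have hne (i : ℕ) (x : ℝ) : deckRoot m ^ i * h x ≠ 0 :=
    mul_ne_zero (pow_ne_zero _ (Complex.exp_ne_zero _)) (h0 x)
  constructor
  · intro i
    refine ⟨isIsotropicImmersion_figureEightGraph (hsm i), fun s t hst => ?_,
      figureEightGraph_mem_hypersurface hpow i⟩
    rcases figureEightGraph_eq_cases h0 hend i.2 i.2 hst with ⟨h, -⟩ | ⟨-, -, h⟩ | ⟨-, -, h⟩
    · exact h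
    · lia
    · lia
  · intro i j hij s t hst
    rcases figureEightGraph_eq_cases h0 hend i.2 j.2 hst with ⟨-, h⟩ | ⟨hs, ht, -⟩ | ⟨hs, ht, -⟩
    · exact absurd (Fin.ext h) hij
    · exact sphereTangent_sup_pole (hsm i) (hsm j) (hne i) (by rw [hs]; norm_num) (by rw [hs, ht])
    · exact sphereTangent_sup_pole (hsm i) (hsm j) (hne i) (by rw [hs]; norm_num)
        (by rw [hs, ht, neg_neg])
  · intro i j hij
    wlog h : (i : ℕ) + 1 = j generalizing i j
    · rw [Set.inter_comm]
      exact this j i hij.symm (hij.resolve_left h)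
    · rw [← h, range_inter_range_eq_singleton h0 hend (by lia), Set.ncard_singleton]
  · intro i j hij
    rw [Set.eq_empty_iff_forall_notMem]
    rintro w ⟨⟨s, rfl⟩, ⟨t, hst⟩⟩
    rcases figureEightGraph_eq_cases h0 hend i.2 j.2 hst.symm with ⟨-, h⟩ | ⟨-, -, h⟩ | ⟨-, -, h⟩ <;>
      lia

theorem deckMap_iterate_figureEightGraph (m : ℕ) (h : ℝ → ℂ) (k : ℕ)
    (x : EuclideanSpace ℝ (Fin 3)) :
    (deckMap m)^[k] (figureEightGraph h x) =
      figureEightGraph (fun y => deckRoot m ^ k * h y) x := by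
  induction k with
  | zero => simp
  | succ k ih =>
    rw [Function.iterate_succ_apply', ih]
    simp [deckMap, figureEightGraph, deckRoot, pow_succ']
    ring

/-! ### Assembly -/

theorem exists_configuration (m : ℕ) :
    ∃ F : S2 → Cn 3, (∀ t, F t ∈ hypersurface m ∧ branchedCover (F t) = figureEight t) ∧
      IsAConfiguration m (hypersurface m) fun (k : Fin m) (t : S2) => (deckMap m)^[k] (F t) := by
  obtain ⟨L, hL, hexp, hsub⟩ := exists_log_figureEightLoop
  have hm : (m : ℂ) + 1 ≠ 0 := by exact_mod_cast m.succ_ne_zero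
  set h : ℝ → ℂ := fun x => Complex.exp (L x / (m + 1))
  have hpow (x : ℝ) : h x ^ (m + 1) = figureEightLoop x := by
    rw [← Complex.exp_nat_mul, ← hexp]
    push_cast
    rw [mul_div_cancel₀ _ hm]
  -- One full turn of `γ` is a turn by `2π/(m+1)` of its root.
  have hend : h 1 = deckRoot m * h (-1) := by
    rw [deckRoot, ← Complex.exp_add, ← hsub, ← add_div, sub_add_cancel]
  refine ⟨fun t => figureEightGraph h t, fun t => ⟨?_, rfl⟩, ?_⟩
  · simpa using figureEightGraph_mem_hypersurface hpow 0 t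
  · simp only [deckMap_iterate_figureEightGraph]
    exact isAConfiguration_figureEightGraph (hL.div_const _).cexp (fun _ => Complex.exp_ne_zero _)
      hpow hend

/-- The first spheres of a configuration form a configuration in every large bounded domain. -/
theorem IsAConfiguration.exists_boundedDomain {m k l : ℕ} {f : Fin k → S2 → Cn 3}
    (hf : IsAConfiguration m (hypersurface m) f) (hl : l ≤ k) :
    ∃ R₀ : ℝ, ∀ R, R₀ ≤ R →
      IsAConfiguration m (boundedDomain m R) fun i : Fin l => f (Fin.castLE hl i) := by
  have hb (i : Fin k) : ∃ C : ℝ, ∀ t, ‖f i t‖ ≤ C := by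
    obtain ⟨C, hC⟩ := isCompact_univ.exists_bound_of_continuousOn
      (hf.lagrangian i).smooth.continuous.continuousOn
    exact ⟨C, fun t => hC t trivial⟩
  choose C hC using hb
  obtain ⟨B, hB⟩ := (Set.finite_range C).bddAbove
  refine ⟨B + 1, fun R hR => ⟨fun i => ?_, fun i j hij => ?_,
    fun i j => hf.adjacent (Fin.castLE hl i) (Fin.castLE hl j),
    fun i j => hf.distant (Fin.castLE hl i) (Fin.castLE hl j)⟩⟩
  · have := hf.lagrangian (Fin.castLE hl i)
    refine ⟨this.toIsIsotropicImmersion, this.injective, fun t => ⟨?_, this.mem t⟩⟩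
    have h1 := hC (Fin.castLE hl i) t
    have h2 := hB ⟨Fin.castLE hl i, rfl⟩
    linarith
  · exact hf.transverse _ _ fun h => hij (Fin.castLE_injective hl h)

theorem mainTheorem3 (m : ℕ) (hm : 1 ≤ m) :
    IsSymplecticHypersurface m ∧
    IsIsotropicImmersion figureEight ∧
    (∃ F : S2 → Cn 3, (∀ t, F t ∈ hypersurface m ∧ branchedCover (F t) = figureEight t) ∧
      IsAConfiguration m (hypersurface m) (fun (k : Fin m) (t : S2) => (deckMap m)^[k] (F t))) ∧
    (3 ≤ m → ∃ R₀ : ℝ, ∀ R : ℝ, R₀ ≤ R → SatisfiesKnottingHypotheses m (boundedDomain m R)) := by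
  refine ⟨isSymplecticHypersurface m, isIsotropicImmersion_figureEight, exists_configuration m,
    fun h3 => ?_⟩
  obtain ⟨F, -, hF⟩ := exists_configuration m
  obtain ⟨R₀, hR₀⟩ := hF.exists_boundedDomain h3
  -- `R₀` makes room for the three spheres; `2` ensures `|z|² ≥ 4` on the boundary.
  refine ⟨max R₀ 2, fun R hR => ?_⟩
  exact
    { contactType := isInteriorOfContactTypeDomain_boundedDomain (by lia) (le_of_max_le_right hR)
      configuration := ⟨_, hR₀ R (le_of_max_le_left hR)⟩
      symplecticClass := symplecticClassVanishes m _
      chernClass := firstChernClassVanishes fun z hz => hz.2 }
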